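/- Let $q$ be a prime power and let $m\ge n\ge 1$ and $t\ge 2$ be integers. Let $V=\mathbb F_q^{n\times m}\times(\mathbb F_q^{1\times 1})^{t-1}$ be the sum-rank-metric space with $\mathbf n=(n,1,\dots,1)$ and $\mathbf m=(m,1,\dots,1)$ (tuples of length $t$). For $X=(X_1,\dots,X_t)\in V$ put $\mathrm{srk}(X)=\sum_{i=1}^t\mathrm{rk}(X_i)$; the distance of $X,Y\in V$ is $\mathrm{srk}(X-Y)$. Let $A$ be the adjacency matrix of the graph on $V$ in which $X,Y$ are adjacent if and only if $\mathrm{srk}(X-Y)=1$, and let $\lambda_1\ge\lambda_2\ge\dots\ge\lambda_{|V|}$ be its eigenvalues. For a real polynomial $p$ put $W(p)=\max_{X\in V}p(A)_{XX}$ and $\lambda(p)=\min_{2\le i\le|V|}p(\lambda_i)$. The Ratio-type bound for minimum distance $3$ is $$\mathrm{RT}=\inf_p\ |V|\,\frac{W(p)-\lambda(p)}{p(\lambda_1)-\lambda(p)},$$ where $p$ ranges over the real polynomials of degree at most $2$ with $p(\lambda_1)>\lambda(p)$. The Sphere-Packing bound for minimum distance $3$ is $$\mathrm{SP}=\frac{|V|}{V_1},\qquad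 V_1=\#\{X\in V:\mathrm{srk}(X)\le 1\}$$ (neither of the two values is rounded down). A perfect code with minimum distance $3$ in $V$ is a subset $C\subseteq V$ with $|C|\ge 2$, with $\mathrm{srk}(X-Y)\ge 3$ for all distinct $X,Y\in C$, and with $|C|=|V|/V_1$. Then: 1. $\mathrm{RT}\le\mathrm{SP}$. 2. If $t\not\equiv 1\pmod q$, then $\mathrm{RT}<\mathrm{SP}$. 3. If $t\not\equiv 1\pmod q$, then $V$ contains no perfect code with minimum distance $3$. -/

import Mathlib

open Polynomial

noncomputable section

/-! ## Sum-rank-metric spaces and codes -/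

/-- The sum-rank-metric space `F^{n₁ × m₁} × ⋯ × F^{n_t × m_t}`. -/
abbrev SumRankSpace (F : Type*) {t : ℕ} (n m : Fin t → ℕ) : Type _ :=
  (i : Fin t) → Matrix (Fin (n i)) (Fin (m i)) F

/-- The sum-rank `srk(X) = ∑ rk(X_i)`. -/
def sumRank {F : Type*} [Field F] {t : ℕ} {n m : Fin t → ℕ} (X : SumRankSpace F n m) : ℕ :=
  ∑ i, (X i).rank

/-- The minimum sum-rank distance of a code; it is `⊤` for codes with at most one element. -/
def minSumRankDist {F : Type*} [Field F] {t : ℕ} {n m : Fin t → ℕ}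
    (C : Set (SumRankSpace F n m)) : ℕ∞ :=
  ⨅ X ∈ C, ⨅ Y ∈ C, ⨅ _ : X ≠ Y, (sumRank (X - Y) : ℕ∞)

/-- The ball of radius `r` centered at `X` in the sum-rank metric. -/
def sumRankBall {F : Type*} [Field F] {t : ℕ} {n m : Fin t → ℕ}
    (X : SumRankSpace F n m) (r : ℕ) : Set (SumRankSpace F n m) :=
  {Y | sumRank (X - Y) ≤ r}

/-- The volume `V_r`: the number of elements of a ball of radius `r` in the sum-rank-metric space. -/
def ballVolume (F : Type*) [Field F] {t : ℕ} (n m : Fin t → ℕ) (r : ℕ) : ℕ :=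
  (sumRankBall (0 : SumRankSpace F n m) r).ncard

/-- The value `|F^{n × m}| / V_r`, `r = ⌊(d - 1) / 2⌋`, of the Sphere-Packing bound for minimum
distance `d`, without rounding. -/
def spherePackingBound (F : Type*) [Field F] {t : ℕ} (n m : Fin t → ℕ) (d : ℕ) : ℝ :=
  (Nat.card (SumRankSpace F n m) : ℝ) / (ballVolume F n m ((d - 1) / 2) : ℝ)

/-- `C` is a perfect code for minimum distance `d`: it has at least two elements, minimum sum-rank
distance at least `d`, and `|C| = |F^{n × m}| / V_r` with `r = ⌊(d - 1) / 2⌋`. -/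
def IsPerfectSumRankCode {F : Type*} [Field F] {t : ℕ} {n m : Fin t → ℕ}
    (C : Set (SumRankSpace F n m)) (d : ℕ) : Prop :=
  2 ≤ C.ncard ∧ (d : ℕ∞) ≤ minSumRankDist C ∧ (C.ncard : ℝ) = spherePackingBound F n m d

/-- The tuple `(a, 1, …, 1)` of length `t`. -/
def oneBlock (t a : ℕ) : Fin t → ℕ := fun i => if (i : ℕ) = 0 then a else 1

/-! ## The sum-rank-metric graph and the Ratio-type bound -/

theorem sumRank_zero {F : Type*} [Field F] {t : ℕ} {n m : Fin t → ℕ} :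
    sumRank (0 : SumRankSpace F n m) = 0 := by
  simp [sumRank]

theorem sumRank_neg {F : Type*} [Field F] {t : ℕ} {n m : Fin t → ℕ} (X : SumRankSpace F n m) :
    sumRank (-X) = sumRank X := by
  have key : ∀ {a b : ℕ} (M : Matrix (Fin a) (Fin b) F), (-M).rank = M.rank := by
    intro a b M
    have h : (-M).mulVecLin = -M.mulVecLin := by
      ext v i
      simp
    rw [Matrix.rank, Matrix.rank, h, LinearMap.range_neg]
  simp [sumRank, key]

/-- The sum-rank-metric graph: two elements are adjacent when their sum-rank distance is `1`. -/
def sumRankGraph (F : Type*) [Field F] {t : ℕ} (n m : Fin t → ℕ) :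
    SimpleGraph (SumRankSpace F n m) where
  Adj X Y := sumRank (X - Y) = 1
  symm := ⟨fun X Y h => by rw [← neg_sub, sumRank_neg]; exact h⟩
  loopless := ⟨fun X h => by simp [sumRank_zero] at h⟩

section RatioType

variable {V : Type*} [Fintype V] [DecidableEq V] (G : SimpleGraph V) [DecidableRel G.Adj]

/-- The eigenvalues `λ₁ ≥ λ₂ ≥ ⋯ ≥ λ_{|V|}` of the adjacency matrix, with multiplicity; the index
`0` belongs to `λ₁`. -/
def adjEigenvalue : Fin (Fintype.card V) → ℝ :=
  (SimpleGraph.isHermitian_adjMatrix ℝ G).eigenvalues₀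

/-- `W(p)`: the maximal diagonal entry of `p(A)`. -/
def ratioW (p : ℝ[X]) : ℝ :=
  ⨆ v : V, (aeval (G.adjMatrix ℝ) p : Matrix V V ℝ) v v

/-- `λ(p) = min_{i ≥ 2} p(λ_i)`. -/
def ratioMin (p : ℝ[X]) : ℝ :=
  ⨅ i : {i : Fin (Fintype.card V) // 0 < (i : ℕ)}, p.eval (adjEigenvalue G i)

/-- `p(λ₁)`. -/
def ratioTop [Nonempty V] (p : ℝ[X]) : ℝ :=
  p.eval (adjEigenvalue G ⟨0, Fintype.card_pos⟩)

/-- The values `|V| (W(p) - λ(p)) / (p(λ₁) - λ(p))` of the Ratio-type bound for minimum distance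
`d`, over all real polynomials `p` of degree at most `d - 1` with `p(λ₁) > λ(p)`. -/
def ratioTypeValues [Nonempty V] (d : ℕ) : Set ℝ :=
  {x | ∃ p : ℝ[X], p.natDegree ≤ d - 1 ∧ ratioMin G p < ratioTop G p ∧
    x = (Fintype.card V : ℝ) * ((ratioW G p - ratioMin G p) / (ratioTop G p - ratioMin G p))}

/-- The trace of `p(A)` is the sum of the values of `p` at the eigenvalues. -/
theorem trace_aeval_adjMatrix (p : ℝ[X]) :
    (aeval (G.adjMatrix ℝ) p : Matrix V V ℝ).trace = ∑ i, p.eval (adjEigenvalue G i) := by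
  have hA := SimpleGraph.isHermitian_adjMatrix ℝ G
  have key : (aeval (G.adjMatrix ℝ) p : Matrix V V ℝ) =
      (hA.eigenvectorUnitary : Matrix V V ℝ) *
        Matrix.diagonal (fun v => p.eval (hA.eigenvalues v)) *
        (star hA.eigenvectorUnitary : Matrix V V ℝ) := by
    have hd : (Matrix.diagonal (fun v => p.eval (hA.eigenvalues v)) : Matrix V V ℝ) =
        aeval (Matrix.diagonal (RCLike.ofReal ∘ hA.eigenvalues) : Matrix V V ℝ) p := by
      refine Eq.trans ?_ (aeval_algHom_apply (Matrix.diagonalAlgHom ℝ) hA.eigenvalues p).symm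
      rw [Matrix.diagonalAlgHom_apply]
      congr 1
      ext v
      exact (coe_aeval_eq_eval (hA.eigenvalues v) ▸
        aeval_algHom_apply (Pi.evalAlgHom ℝ (fun _ : V => ℝ) v) hA.eigenvalues p)
    rw [hd, ← Unitary.conjStarAlgAut_apply (S := ℝ)]
    conv_lhs => rw [hA.spectral_theorem]
    exact aeval_algHom_apply
      (Unitary.conjStarAlgAut ℝ _ hA.eigenvectorUnitary).toAlgEquiv.toAlgHom _ p
  rw [key, Matrix.trace_mul_comm, ← mul_assoc]
  simp only [Unitary.coe_star_mul_self, one_mul, Matrix.trace_diagonal]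
  exact (Fintype.equivOfCardEq (Fintype.card_fin (Fintype.card V))).symm.sum_comp
    fun i => p.eval (hA.eigenvalues₀ i)

/-- The values of the Ratio-type bound are bounded below, so that their infimum is meaningful. -/
theorem one_le_of_mem_ratioTypeValues [Nonempty V] (d : ℕ) {x : ℝ}
    (hx : x ∈ ratioTypeValues G d) : 1 ≤ x := by
  obtain ⟨p, -, hp, rfl⟩ := hx
  have hW : ∀ v : V, (aeval (G.adjMatrix ℝ) p : Matrix V V ℝ) v v ≤ ratioW G p :=
    fun v => le_ciSup (f := fun v : V => (aeval (G.adjMatrix ℝ) p : Matrix V V ℝ) v v)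
      (Set.finite_range _).bddAbove v
  have h1 : (aeval (G.adjMatrix ℝ) p : Matrix V V ℝ).trace ≤ Fintype.card V * ratioW G p := by
    simpa [Matrix.trace] using Finset.sum_le_sum fun v (_ : v ∈ Finset.univ) => hW v
  have h2 : ratioTop G p - ratioMin G p
      ≤ ∑ i, (p.eval (adjEigenvalue G i) - ratioMin G p) := by
    rw [← Finset.add_sum_erase _ _ (Finset.mem_univ ⟨0, Fintype.card_pos⟩)]
    refine le_add_of_nonneg_right (Finset.sum_nonneg fun i hi => sub_nonneg.2 ?_)
    have hi0 : 0 < (i : ℕ) := by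
      rcases Nat.eq_zero_or_pos (i : ℕ) with h | h
      · exact absurd (Fin.ext h) (Finset.ne_of_mem_erase hi)
      · exact h
    exact ciInf_le (f := fun i : {i : Fin (Fintype.card V) // 0 < (i : ℕ)} =>
      p.eval (adjEigenvalue G i)) (Set.finite_range _).bddBelow ⟨i, hi0⟩
  rw [Finset.sum_sub_distrib, ← trace_aeval_adjMatrix] at h2
  simp only [Finset.sum_const, Finset.card_univ, Fintype.card_fin, nsmul_eq_mul] at h2
  rw [← mul_div_assoc, one_le_div (sub_pos.2 hp)]
  linarith

end RatioType

open Classical in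
/-- `RT(q, n, m, d)`: the best value of the Ratio-type bound for the sum-rank-metric graph. -/
def ratioTypeBound (F : Type*) [Field F] [Fintype F] {t : ℕ} (n m : Fin t → ℕ) (d : ℕ) : ℝ :=
  sInf (ratioTypeValues (sumRankGraph F n m) d)

end

open Finset Matrix

/-! ## Elements of sum-rank one -/

/-! The elements of sum-rank one, together with `0`, form `N` lines through the origin that meet
only in `0`. Hence `A = q ∑ P_l - N`, where `P_l` averages functions along the line `l`. The `P_l`
are commuting idempotents, so every eigenvalue is `q z - N` with an integer `0 ≤ z ≤ N`
(`exists_nat_of_adjMatrix_mulVec_eq_smul`). The graph is regular of degree `k = (q - 1) N`, `V_1 = k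
+ 1`, and `N ≡ t` mod `q`.

Let `a ≤ -1 < b = a + q` be consecutive in the progression `q ℤ - N`. Then `p = (X - a)(X - b)` is
nonnegative on the spectrum and `W(p) = k + a b`. The bound given by `p` is at most `|V| W(p) /
p(k)`, and `(k + 1) W(p) = p(k) + k (a + 1)(b + 1)`. The last term is at most `0`, and it is
negative unless `a = -1`, that is, unless `t ≡ 1` mod `q`.

A perfect code makes `-1` an eigenvalue (`exists_adjMatrix_mulVec_eq_neg`), which again forces `N ≡
1`. -/

theorem Matrix.exists_eq_vecMulVec_of_rank_eq_one {F : Type*} [Field F] {a b : ℕ}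
    {M : Matrix (Fin a) (Fin b) F} (hM : M.rank = 1) :
    ∃ u v, u ≠ 0 ∧ v ≠ 0 ∧ M = vecMulVec u v := by
  obtain ⟨w, hw, h⟩ := finrank_eq_one_iff'.1 hM
  -- The column space is spanned by `w`, so column `j` is `c j • w`.
  choose c hc using fun j => h ⟨M *ᵥ Pi.single j 1, ⟨Pi.single j 1, rfl⟩⟩
  have hMc : M = vecMulVec (w : Fin a → F) c := by
    ext i j
    have := congrFun (congrArg Subtype.val (hc j)) i
    simp only [mulVec_single_one, SetLike.val_smul, Pi.smul_apply, smul_eq_mul, col_apply] at this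
    rw [vecMulVec_apply, mul_comm, this]
  refine ⟨w, c, fun h0 => hw (Subtype.ext h0), ?_, hMc⟩
  rintro rfl
  have h0 : vecMulVec (w : Fin a → F) (0 : Fin b → F) = 0 := by
    ext
    simp [vecMulVec_apply]
  rw [hMc, h0, rank_zero] at hM
  exact zero_ne_one hM

theorem Matrix.rank_eq_zero_iff_eq_zero {F : Type*} [Field F] {a b : ℕ}
    {M : Matrix (Fin a) (Fin b) F} : M.rank = 0 ↔ M = 0 := by
  refine ⟨fun h => ?_, fun h => by simp [h]⟩
  rw [Matrix.rank, Submodule.finrank_eq_zero, LinearMap.range_eq_bot] at h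
  ext i j
  simpa using congrFun (LinearMap.congr_fun h (Pi.single j 1)) i

theorem Matrix.rank_add_le_rank_add_rank {F : Type*} [Field F] {a b : ℕ}
    (M N : Matrix (Fin a) (Fin b) F) : (M + N).rank ≤ M.rank + N.rank := by
  rw [Matrix.rank, Matrix.mulVecLin_add]
  exact (Submodule.finrank_mono (LinearMap.range_add_le _ _)).trans
    (Submodule.finrank_add_le_finrank_add_finrank _ _)

theorem Matrix.rank_vecMulVec_of_ne_zero {F : Type*} [Field F] {a b : ℕ}
    {u : Fin a → F} {v : Fin b → F} (hu : u ≠ 0) (hv : v ≠ 0) : (vecMulVec u v).rank = 1 := by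
  refine le_antisymm (rank_vecMulVec_le u v) (Nat.one_le_iff_ne_zero.2 fun h => ?_)
  rw [rank_eq_zero_iff_eq_zero] at h
  obtain ⟨i, hi⟩ := Function.ne_iff.1 hu
  obtain ⟨j, hj⟩ := Function.ne_iff.1 hv
  exact mul_ne_zero hi hj (congrFun (congrFun h i) j)

section SumRank

variable {F : Type*} [Field F] {t : ℕ} {n m : Fin t → ℕ}

theorem sumRank_eq_zero {X : SumRankSpace F n m} : sumRank X = 0 ↔ X = 0 := by
  simp [sumRank, Matrix.rank_eq_zero_iff_eq_zero, funext_iff (f := X)]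

theorem sumRank_add_le (X Y : SumRankSpace F n m) :
    sumRank (X + Y) ≤ sumRank X + sumRank Y := by
  simp only [sumRank, ← Finset.sum_add_distrib]
  exact Finset.sum_le_sum fun i _ => Matrix.rank_add_le_rank_add_rank _ _

theorem sumRank_single (i : Fin t) (M : Matrix (Fin (n i)) (Fin (m i)) F) :
    sumRank (Pi.single i M : SumRankSpace F n m) = M.rank := by
  rw [sumRank, Finset.sum_eq_single i]
  · simp
  · intro j _ hj
    simp [Pi.single_eq_of_ne hj]
  · simp

theorem exists_eq_single_of_sumRank_eq_one {X : SumRankSpace F n m} (hX : sumRank X = 1) :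
    ∃ i, ∃ M : Matrix (Fin (n i)) (Fin (m i)) F, M.rank = 1 ∧ X = Pi.single i M := by
  have h0 : ∃ i, (X i).rank ≠ 0 := by
    by_contra! h
    simp [sumRank, h] at hX
  obtain ⟨i, hi⟩ := h0
  rw [sumRank, ← Finset.add_sum_erase _ _ (Finset.mem_univ i)] at hX
  refine ⟨i, X i, by omega, funext fun j => ?_⟩
  rcases eq_or_ne j i with rfl | hj
  · simp
  · have hs : ∑ k ∈ Finset.univ.erase i, (X k).rank = 0 := by omega
    rw [Finset.sum_eq_zero_iff] at hs
    rw [Pi.single_eq_of_ne hj]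
    exact Matrix.rank_eq_zero_iff_eq_zero.1 (hs j (by simp [hj]))

variable (F n m) in
/-- The lines spanned by the elements of sum-rank one. -/
abbrev RankOneLine : Type _ :=
  Σ i : Fin t, Projectivization F (Fin (n i) → F) × Projectivization F (Fin (m i) → F)

/-- A generator of a line. -/
noncomputable def RankOneLine.gen (l : RankOneLine F n m) : SumRankSpace F n m :=
  Pi.single l.1 (vecMulVec l.2.1.rep l.2.2.rep)

theorem sumRank_smul_gen (c : Fˣ) (l : RankOneLine F n m) : sumRank (c • l.gen) = 1 := by
  rw [RankOneLine.gen, Units.smul_def, ← Pi.single_smul, sumRank_single, ← smul_vecMulVec]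
  exact Matrix.rank_vecMulVec_of_ne_zero (smul_ne_zero c.ne_zero (Projectivization.rep_nonzero _))
    (Projectivization.rep_nonzero _)

theorem exists_smul_gen_eq {X : SumRankSpace F n m} (hX : sumRank X = 1) :
    ∃ (l : RankOneLine F n m) (c : Fˣ), c • l.gen = X := by
  obtain ⟨i, M, hM, rfl⟩ := exists_eq_single_of_sumRank_eq_one hX
  obtain ⟨u, v, hu, hv, rfl⟩ := Matrix.exists_eq_vecMulVec_of_rank_eq_one hM
  obtain ⟨a, ha⟩ := Projectivization.exists_smul_eq_mk_rep F u hu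
  obtain ⟨b, hb⟩ := Projectivization.exists_smul_eq_mk_rep F v hv
  refine ⟨⟨i, .mk F u hu, .mk F v hv⟩, (a * b)⁻¹, ?_⟩
  rw [inv_smul_eq_iff, RankOneLine.gen, Units.smul_def, ← Pi.single_smul, ← ha, ← hb]
  congr 1
  ext j k
  simp [vecMulVec_apply, Units.smul_def]
  ring

theorem Projectivization.eq_of_smul_rep_eq {V : Type*} [AddCommGroup V] [Module F V]
    {x y : Projectivization F V} {a b : F} (ha : a ≠ 0) (h : a • x.rep = b • y.rep) : x = y := by
  rw [← x.mk_rep, ← y.mk_rep, Projectivization.mk_eq_mk_iff']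
  refine ⟨a⁻¹ * b, ?_⟩
  rw [mul_smul, ← h, inv_smul_smul₀ ha]

/-- Coordinates `j`, `k` where the representatives do not vanish detect the block, then the two
projective points, then the scalar. -/
theorem smul_gen_injective :
    Function.Injective fun p : RankOneLine F n m × Fˣ => p.2 • p.1.gen := by
  rintro ⟨⟨i, x, y⟩, c⟩ ⟨⟨i', x', y'⟩, c'⟩ h
  obtain ⟨j, hj⟩ := Function.ne_iff.1 x.rep_nonzero
  obtain ⟨k, hk⟩ := Function.ne_iff.1 y.rep_nonzero
  simp only [Pi.zero_apply] at hj hk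
  simp only [RankOneLine.gen, Units.smul_def, ← Pi.single_smul] at h
  have hi : i = i' := by
    by_contra hne
    have := congrFun (congrFun (congrFun h i) j) k
    rw [Pi.single_eq_of_ne hne] at this
    simp [vecMulVec_apply, hj, hk] at this
  subst hi
  have h' : ∀ r s, (c : F) * (x.rep r * y.rep s) = c' * (x'.rep r * y'.rep s) := fun r s => by
    simpa [vecMulVec_apply] using congrFun (congrFun (Pi.single_injective _ h) r) s
  have hx : x = x' := by
    refine Projectivization.eq_of_smul_rep_eq (a := c * y.rep k) (b := c' * y'.rep k)
      (mul_ne_zero c.ne_zero hk) (funext fun r => ?_)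
    simp only [Pi.smul_apply, smul_eq_mul]
    linear_combination h' r k
  have hy : y = y' := by
    refine Projectivization.eq_of_smul_rep_eq (a := c * x.rep j) (b := c' * x'.rep j)
      (mul_ne_zero c.ne_zero hj) (funext fun r => ?_)
    simp only [Pi.smul_apply, smul_eq_mul]
    linear_combination h' j r
  subst hx hy
  have hc : c = c' := Units.ext (mul_right_cancel₀ (mul_ne_zero hj hk) (h' j k))
  rw [hc]

/-- The number of points is `1 + q + ⋯ + q ^ (a - 1)`. -/
theorem card_projectivization_modEq_one [Finite F] {a : ℕ} (ha : 1 ≤ a) :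
    Nat.card (Projectivization F (Fin a → F)) ≡ 1 [MOD Nat.card F] := by
  obtain ⟨a, rfl⟩ := Nat.exists_eq_add_of_le' ha
  rw [Projectivization.card_of_finrank F _ (Module.finrank_fin_fun F), Finset.sum_range_succ']
  simp only [pow_zero]
  refine Nat.ModEq.add_right 1 (Nat.modEq_zero_iff_dvd.2 (Finset.dvd_sum fun i _ => ?_))
  exact dvd_pow_self _ i.succ_ne_zero

theorem card_rankOneLine [Finite F] : Nat.card (RankOneLine F n m) =
    ∑ i, Nat.card (Projectivization F (Fin (n i) → F)) *
      Nat.card (Projectivization F (Fin (m i) → F)) := by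
  simp [Nat.card_sigma, Nat.card_prod]

theorem card_rankOneLine_modEq [Finite F] (hn : ∀ i, 1 ≤ n i) (hm : ∀ i, 1 ≤ m i) :
    Nat.card (RankOneLine F n m) ≡ t [MOD Nat.card F] := by
  rw [card_rankOneLine]
  calc _ ≡ ∑ i : Fin t, 1 * 1 [MOD Nat.card F] := Nat.ModEq.sum fun i _ =>
        (card_projectivization_modEq_one (hn i)).mul (card_projectivization_modEq_one (hm i))
    _ = t := by simp

theorem le_card_rankOneLine [Finite F] (hn : ∀ i, 1 ≤ n i) (hm : ∀ i, 1 ≤ m i) :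
    t ≤ Nat.card (RankOneLine F n m) := by
  have h : ∀ {a : ℕ}, 1 ≤ a → 1 ≤ Nat.card (Projectivization F (Fin a → F)) := fun {a} ha => by
    have : Nonempty (Fin a) := ⟨⟨0, ha⟩⟩
    exact Nat.card_pos
  rw [card_rankOneLine]
  calc t = ∑ i : Fin t, 1 * 1 := by simp
    _ ≤ _ := Finset.sum_le_sum fun i _ => Nat.mul_le_mul (h (hn i)) (h (hm i))

end SumRank

/-! ## Eigenvalues of the sum-rank-metric graph -/

/-- Remove one idempotent `P i` at a time: if it kills `v`, then `v` stays an eigenvector for `μ`;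
otherwise `P i v` is an eigenvector of the remaining sum for `μ - 1`. -/
theorem exists_nat_eq_of_sum_idempotent_apply_eq_smul {E ι : Type*} [AddCommGroup E] [Module ℝ E]
    {P : ι → Module.End ℝ E} (hcomm : ∀ i j, Commute (P i) (P j))
    (hidem : ∀ i, IsIdempotentElem (P i)) (s : Finset ι) :
    ∀ {v : E} {μ : ℝ}, v ≠ 0 → (∑ i ∈ s, P i) v = μ • v → ∃ z : ℕ, z ≤ #s ∧ μ = z := by
  classical
  induction s using Finset.induction_on with
  | empty =>
    intro v μ hv h
    refine ⟨0, le_rfl, ?_⟩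
    simpa [hv, eq_comm] using h
  | insert i s hi ih =>
    intro v μ hv h
    rw [Finset.sum_insert hi, LinearMap.add_apply] at h
    rw [Finset.card_insert_of_notMem hi]
    by_cases h0 : P i v = 0
    · rw [h0, zero_add] at h
      obtain ⟨z, hz, rfl⟩ := ih hv h
      exact ⟨z, by omega, rfl⟩
    · have hii : P i (P i v) = P i v := LinearMap.congr_fun (hidem i) v
      have hc : (∑ j ∈ s, P j) (P i v) = P i ((∑ j ∈ s, P j) v) :=
        LinearMap.congr_fun (Commute.sum_left s P (P i) fun j _ => hcomm j i) v
      have hw : (∑ j ∈ s, P j) (P i v) = (μ - 1) • P i v := by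
        rw [hc, eq_sub_of_add_eq' h, map_sub, map_smul, hii, sub_smul, one_smul]
      obtain ⟨z, hz, hμ⟩ := ih h0 hw
      exact ⟨z + 1, by omega, by push_cast; linarith⟩

/-! ### Averaging operators along lines -/

section LineAverage

variable {F V : Type*} [Field F] [Fintype F] [AddCommGroup V] [Module F V]

variable (F) in
/-- The operator that averages a function along the translates of the line spanned by `g`. -/
noncomputable def lineAverage (g : V) : Module.End ℝ (V → ℝ) where
  toFun f x := (Fintype.card F : ℝ)⁻¹ * ∑ c : F, f (x + c • g)
  map_add' f h := by
    ext x
    simp [Finset.sum_add_distrib, mul_add]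
  map_smul' r f := by
    ext x
    simp only [Pi.smul_apply, smul_eq_mul, ← Finset.mul_sum, RingHom.id_apply]
    ring

theorem lineAverage_apply (g : V) (f : V → ℝ) (x : V) :
    lineAverage F g f x = (Fintype.card F : ℝ)⁻¹ * ∑ c : F, f (x + c • g) := rfl

theorem commute_lineAverage (g h : V) : Commute (lineAverage F g) (lineAverage F h) := by
  refine LinearMap.ext fun f => funext fun x => ?_
  simp only [Module.End.mul_apply, lineAverage_apply, ← Finset.mul_sum]
  rw [Finset.sum_comm]
  simp only [add_right_comm]

theorem isIdempotentElem_lineAverage (g : V) : IsIdempotentElem (lineAverage F g) := by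
  refine LinearMap.ext fun f => funext fun x => ?_
  have h : ∀ c : F, ∑ d : F, f (x + c • g + d • g) = ∑ d : F, f (x + d • g) := fun c => by
    simp only [add_assoc, ← add_smul]
    exact Equiv.sum_comp (Equiv.addLeft c) fun d : F => f (x + d • g)
  simp only [Module.End.mul_apply, lineAverage_apply, h]
  simp

theorem sum_units_smul [DecidableEq F] (g x : V) (f : V → ℝ) :
    ∑ c : Fˣ, f (x + c • g) = Fintype.card F * lineAverage F g f x - f x := by
  have h : ∑ c : F, f (x + c • g) = f x + ∑ c : Fˣ, f (x + c • g) := by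
    rw [Fintype.sum_eq_add_sum_subtype_ne _ (0 : F), zero_smul, add_zero]
    congr 1
    exact (unitsEquivNeZero.sum_comp fun c : {c : F // c ≠ 0} => f (x + (c : F) • g)).symm
  rw [lineAverage_apply, mul_inv_cancel_left₀ (by simp), h, add_sub_cancel_left]

end LineAverage

/-! ### Degree and spectrum of the sum-rank-metric graph -/

section SumRankGraph

variable {F : Type*} [Field F] [Fintype F] {t : ℕ} {n m : Fin t → ℕ}
  [Fintype (SumRankSpace F n m)] [DecidableRel (sumRankGraph F n m).Adj]

theorem sum_neighborFinset_sumRankGraph [DecidableEq F] [Fintype (RankOneLine F n m)] {R : Type*}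
    [AddCommMonoid R] (f : SumRankSpace F n m → R) (x : SumRankSpace F n m) :
    ∑ y ∈ (sumRankGraph F n m).neighborFinset x, f y =
      ∑ l : RankOneLine F n m, ∑ c : Fˣ, f (x + c • l.gen) := by
  rw [← Fintype.sum_prod_type' fun (l : RankOneLine F n m) (c : Fˣ) => f (x + c • l.gen)]
  symm
  refine Finset.sum_bij (fun p _ => x + p.2 • p.1.gen) ?_ ?_ ?_ fun _ _ => rfl
  · intro p _
    rw [SimpleGraph.mem_neighborFinset]
    change sumRank _ = 1
    rw [sub_add_cancel_left, sumRank_neg, sumRank_smul_gen]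
  · intro p _ p' _ h
    exact smul_gen_injective (add_left_cancel h)
  · intro y hy
    rw [SimpleGraph.mem_neighborFinset] at hy
    have hy' : sumRank (y - x) = 1 := by
      rw [← neg_sub, sumRank_neg]
      exact hy
    obtain ⟨l, c, h⟩ := exists_smul_gen_eq hy'
    exact ⟨(l, c), Finset.mem_univ _, by rw [h]; abel⟩

theorem isRegularOfDegree_sumRankGraph : (sumRankGraph F n m).IsRegularOfDegree
    ((Fintype.card F - 1) * Nat.card (RankOneLine F n m)) := by
  classical
  have : Fintype (RankOneLine F n m) := Fintype.ofFinite _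
  intro x
  rw [← SimpleGraph.card_neighborFinset_eq_degree, Finset.card_eq_sum_ones,
    sum_neighborFinset_sumRankGraph]
  simp [Fintype.card_units, mul_comm]

theorem exists_nat_of_adjMatrix_mulVec_eq_smul {f : SumRankSpace F n m → ℝ} {μ : ℝ} (hf : f ≠ 0)
    (h : (sumRankGraph F n m).adjMatrix ℝ *ᵥ f = μ • f) :
    ∃ z : ℕ, z ≤ Nat.card (RankOneLine F n m) ∧
      μ = Fintype.card F * z - Nat.card (RankOneLine F n m) := by
  classical
  have : Fintype (RankOneLine F n m) := Fintype.ofFinite _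
  have hq : (Fintype.card F : ℝ) ≠ 0 := by simp
  rw [Nat.card_eq_fintype_card]
  -- Summing over the nonzero points of each line gives `A = q ∑ P_l - N`, solved here for `∑ P_l`.
  have key : (∑ l : RankOneLine F n m, lineAverage F l.gen) f =
      ((μ + Fintype.card (RankOneLine F n m)) / Fintype.card F : ℝ) • f := by
    ext x
    have hx := congrFun h x
    rw [SimpleGraph.adjMatrix_mulVec_apply, sum_neighborFinset_sumRankGraph] at hx
    simp only [sum_units_smul, Finset.sum_sub_distrib, ← Finset.mul_sum, Finset.sum_const,
      Finset.card_univ, nsmul_eq_mul, Pi.smul_apply, smul_eq_mul] at hx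
    rw [LinearMap.sum_apply, Finset.sum_apply, Pi.smul_apply, smul_eq_mul]
    field_simp
    linarith
  obtain ⟨z, hz, h'⟩ := exists_nat_eq_of_sum_idempotent_apply_eq_smul
    (fun l l' : RankOneLine F n m => commute_lineAverage l.gen l'.gen)
    (fun l => isIdempotentElem_lineAverage l.gen) Finset.univ hf key
  refine ⟨z, by simpa using hz, ?_⟩
  field_simp at h'
  linarith

end SumRankGraph

/-! ## Ratio-type bound and perfect codes in regular graphs -/

section Regular

variable {V : Type*} [Fintype V] [DecidableEq V] (G : SimpleGraph V) [DecidableRel G.Adj]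

theorem exists_adjMatrix_mulVec_eq_adjEigenvalue_smul (i : Fin (Fintype.card V)) :
    ∃ f : V → ℝ, f ≠ 0 ∧ G.adjMatrix ℝ *ᵥ f = adjEigenvalue G i • f := by
  have hA := SimpleGraph.isHermitian_adjMatrix ℝ G
  let e : Fin (Fintype.card V) ≃ V := Fintype.equivOfCardEq (Fintype.card_fin _)
  have hev : hA.eigenvalues (e i) = adjEigenvalue G i := by
    simp [Matrix.IsHermitian.eigenvalues, adjEigenvalue, e]
  refine ⟨hA.eigenvectorBasis (e i), fun h => ?_, by rw [← hev, hA.mulVec_eigenvectorBasis]⟩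
  exact hA.eigenvectorBasis.orthonormal.ne_zero (e i) (by ext v; exact congrFun h v)

variable {G} in
theorem adjEigenvalue_zero_eq_degree [Nonempty V] {k : ℕ} (hk : G.IsRegularOfDegree k)
    (hle : ∀ i, adjEigenvalue G i ≤ k) :
    adjEigenvalue G ⟨0, Fintype.card_pos⟩ = k := by
  have hA := SimpleGraph.isHermitian_adjMatrix ℝ G
  have hmem : (k : ℝ) ∈ spectrum ℝ (G.adjMatrix ℝ) := by
    rw [← Matrix.spectrum_toLin']
    refine (Module.End.hasEigenvalue_of_hasEigenvector
      (x := Function.const V (1 : ℝ)) ⟨?_, ?_⟩).mem_spectrum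
    · rw [Module.End.mem_eigenspace_iff, Matrix.toLin'_apply]
      ext v
      rw [SimpleGraph.adjMatrix_mulVec_const_apply_of_regular hk]
      simp
    · intro h
      simpa using congrFun h (Classical.arbitrary V)
  rw [hA.spectrum_real_eq_range_eigenvalues] at hmem
  obtain ⟨v, hv⟩ := hmem
  refine le_antisymm (hle _) ?_
  rw [← hv]
  exact hA.eigenvalues₀_antitone (Nat.zero_le _)

variable {G} in
-- The diagonal of `A` is `0` and that of `A ^ 2` is the degree.
theorem ratioW_quadratic [Nonempty V] {k : ℕ} (hk : G.IsRegularOfDegree k) (a b : ℝ) :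
    ratioW G ((X - C a) * (X - C b)) = k + a * b := by
  have h : ∀ v, (aeval (G.adjMatrix ℝ) ((X - C a) * (X - C b)) : Matrix V V ℝ) v v =
      k + a * b := fun v => by
    have hd : (G.adjMatrix ℝ) v v = 0 := by simp
    simp only [map_mul, map_sub, aeval_X, aeval_C, sub_mul, mul_sub, Matrix.sub_apply,
      SimpleGraph.adjMatrix_mul_self_apply_self, hk v, Algebra.algebraMap_eq_smul_one,
      Matrix.smul_mul, Matrix.mul_smul, one_mul, mul_one, Matrix.smul_apply, hd, Matrix.one_apply_eq,
      smul_eq_mul]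
    ring
  simp only [ratioW, h, ciSup_const]

/-- Makes `p` admissible without any knowledge of the second eigenvalue: otherwise all `p(λ_i)` are
at least `p(λ₁)`, and the trace of `p(A)` exceeds `|V| W(p)`. -/
theorem ratioMin_lt_ratioTop [Nonempty V] {p : ℝ[X]} (h : ratioW G p < ratioTop G p) :
    ratioMin G p < ratioTop G p := by
  by_contra! hle
  have hW : ∀ v : V, (aeval (G.adjMatrix ℝ) p : Matrix V V ℝ) v v ≤ ratioW G p :=
    fun v => le_ciSup (f := fun v : V => (aeval (G.adjMatrix ℝ) p : Matrix V V ℝ) v v)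
      (Set.finite_range _).bddAbove v
  have h1 : (aeval (G.adjMatrix ℝ) p : Matrix V V ℝ).trace ≤ Fintype.card V * ratioW G p := by
    simpa [Matrix.trace] using Finset.sum_le_sum fun v (_ : v ∈ Finset.univ) => hW v
  have h2 : Fintype.card V * ratioTop G p ≤ ∑ i, p.eval (adjEigenvalue G i) := by
    have : ∀ i ∈ Finset.univ, ratioTop G p ≤ p.eval (adjEigenvalue G i) := fun i _ => by
      rcases Nat.eq_zero_or_pos (i : ℕ) with hi | hi
      · rw [Fin.ext (b := ⟨0, Fintype.card_pos⟩) hi, ratioTop]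
      · exact hle.trans (ciInf_le (f := fun i : {i : Fin (Fintype.card V) // 0 < (i : ℕ)} =>
          p.eval (adjEigenvalue G i)) (Set.finite_range _).bddBelow ⟨i, hi⟩)
    simpa using Finset.card_nsmul_le_sum _ _ _ this
  rw [trace_aeval_adjMatrix] at h1
  have : (0 : ℝ) < Fintype.card V := by exact_mod_cast Fintype.card_pos
  nlinarith

variable {G} in
theorem exists_mem_ratioTypeValues_le [Nonempty V] (hV : 1 < Fintype.card V) {k : ℕ}
    (hk : G.IsRegularOfDegree k) (hle : ∀ i, adjEigenvalue G i ≤ k) {a b : ℝ}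
    (hab : ∀ i, 0 ≤ (adjEigenvalue G i - a) * (adjEigenvalue G i - b))
    (hlt : k + a * b < (k - a) * (k - b)) :
    ∃ x ∈ ratioTypeValues G 3, x ≤ Fintype.card V * ((k + a * b) / ((k - a) * (k - b))) := by
  set p : ℝ[X] := (X - C a) * (X - C b) with hp
  have htop : ratioTop G p = (k - a) * (k - b) := by
    rw [ratioTop, adjEigenvalue_zero_eq_degree hk hle]
    simp [hp]
  have hW : ratioW G p = k + a * b := ratioW_quadratic hk a b
  have hmin : ratioMin G p < ratioTop G p := ratioMin_lt_ratioTop G (by rwa [htop, hW])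
  have h0 : 0 ≤ ratioMin G p := by
    have : Nonempty {i : Fin (Fintype.card V) // 0 < (i : ℕ)} := ⟨⟨⟨1, hV⟩, Nat.one_pos⟩⟩
    exact le_ciInf fun i => by simpa [hp] using hab i
  refine ⟨_, ⟨p, ?_, hmin, rfl⟩, mul_le_mul_of_nonneg_left ?_ (Nat.cast_nonneg _)⟩
  · exact natDegree_mul_le.trans (by simp)
  -- After cross-multiplication the claim is `0 ≤ λ(p) (p(λ₁) - W(p))`.
  · rw [← htop, ← hW, div_le_div_iff₀ (sub_pos.2 hmin) (h0.trans_lt hmin)]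
    rw [← htop, ← hW] at hlt
    nlinarith

variable {G} in
-- Each closed neighbourhood contains at most one point of `S`, and counting makes it exactly one.
-- So the indicator `f` satisfies `(A + 1) f = 1`, and `(k + 1) f - 1` is the eigenvector.
theorem exists_adjMatrix_mulVec_eq_neg {k : ℕ} (hk : G.IsRegularOfDegree k) (hk0 : k ≠ 0)
    {S : Finset V} (hS : S.Nonempty)
    (hdisj : ∀ x, ∀ c ∈ S, ∀ d ∈ S, (c = x ∨ G.Adj x c) → (d = x ∨ G.Adj x d) → c = d)
    (hcard : #S * (k + 1) = Fintype.card V) :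
    ∃ f : V → ℝ, f ≠ 0 ∧ G.adjMatrix ℝ *ᵥ f = (-1 : ℝ) • f := by
  let f : V → ℝ := fun x => if x ∈ S then 1 else 0
  have hf : ∑ x, f x = #S := by simp [f]
  have hle : ∀ x ∈ Finset.univ, f x + (G.adjMatrix ℝ *ᵥ f) x ≤ 1 := fun x _ => by
    rw [SimpleGraph.adjMatrix_mulVec_apply, ← Finset.sum_insert (by simp)]
    simp only [f, Finset.sum_ite_mem, Finset.sum_const, nsmul_eq_mul, mul_one]
    exact_mod_cast Finset.card_le_one.2 fun c hc d hd => by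
      simp only [Finset.mem_inter, Finset.mem_insert, SimpleGraph.mem_neighborFinset] at hc hd
      exact hdisj x c hc.2 d hd.2 hc.1 hd.1
  have hsum : ∑ x, (f x + (G.adjMatrix ℝ *ᵥ f) x) = ∑ x : V, (1 : ℝ) := by
    have hA : ∑ x, (G.adjMatrix ℝ *ᵥ f) x = k * #S := by
      simp only [Matrix.mulVec, dotProduct]
      rw [Finset.sum_comm, ← hf, Finset.mul_sum]
      refine Finset.sum_congr rfl fun y _ => ?_
      rw [← Finset.sum_mul]
      congr 1
      have := SimpleGraph.adjMatrix_mulVec_const_apply_of_regular (a := (1 : ℝ)) (v := y) hk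
      simpa [Matrix.mulVec, dotProduct, SimpleGraph.adjMatrix_apply, G.adj_comm] using this
    rw [Finset.sum_add_distrib, hf, hA]
    simp only [Finset.sum_const, Finset.card_univ, nsmul_eq_mul, mul_one, ← hcard]
    push_cast
    ring
  have hone := (Finset.sum_eq_sum_iff_of_le hle).1 hsum
  refine ⟨(k + 1 : ℝ) • f - Function.const V 1, fun h => ?_, ?_⟩
  -- At a point of `S` the vector takes the value `k ≠ 0`.
  · obtain ⟨c, hc⟩ := hS
    have := congrFun h c
    simp [f, hc, hk0] at this
  · ext x
    rw [Matrix.mulVec_sub, Matrix.mulVec_smul, Pi.sub_apply,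
      SimpleGraph.adjMatrix_mulVec_const_apply_of_regular hk]
    have := hone x (Finset.mem_univ x)
    simp only [Pi.smul_apply, Pi.sub_apply, smul_eq_mul, Function.const_apply]
    linear_combination (k + 1 : ℝ) * this

end Regular

/-! ### Perfect codes and comparison of the two bounds -/

section SumRankCodes

variable {F : Type*} [Field F] [Fintype F] {t : ℕ} {n m : Fin t → ℕ}

theorem ballVolume_one : ballVolume F n m 1 =
    (Fintype.card F - 1) * Nat.card (RankOneLine F n m) + 1 := by
  classical
  rw [← isRegularOfDegree_sumRankGraph (F := F) (n := n) (m := m) 0,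
    ← SimpleGraph.card_neighborFinset_eq_degree, ← Finset.card_insert_of_notMem (a := 0) (by simp),
    ballVolume, ← Set.ncard_coe_finset]
  congr 1
  ext Y
  rw [Finset.mem_coe, Finset.mem_insert, SimpleGraph.mem_neighborFinset]
  change sumRank (0 - Y) ≤ 1 ↔ Y = 0 ∨ sumRank (0 - Y) = 1
  rw [zero_sub, sumRank_neg, ← sumRank_eq_zero]
  omega

omit [Fintype F] in
theorem three_le_sumRank_sub_of_le_minSumRankDist {C : Set (SumRankSpace F n m)}
    (hC : ((3 : ℕ) : ℕ∞) ≤ minSumRankDist C) {c d : SumRankSpace F n m} (hc : c ∈ C) (hd : d ∈ C)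
    (hcd : c ≠ d) : 3 ≤ sumRank (c - d) := by
  have h : minSumRankDist C ≤ (sumRank (c - d) : ℕ∞) :=
    iInf₂_le_of_le c hc (iInf₂_le_of_le d hd (iInf_le _ hcd))
  exact_mod_cast hC.trans h

theorem modEq_one_of_isPerfectSumRankCode (hn : ∀ i, 1 ≤ n i) (hm : ∀ i, 1 ≤ m i) (ht : 1 ≤ t)
    {C : Set (SumRankSpace F n m)} (hC : IsPerfectSumRankCode C 3) :
    t ≡ 1 [MOD Fintype.card F] := by
  classical
  obtain ⟨h2, hd, hcard⟩ := hC
  have hN := le_card_rankOneLine (F := F) hn hm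
  have hNt := card_rankOneLine_modEq (F := F) hn hm
  have hq : 1 < Fintype.card F := Fintype.one_lt_card
  have hk := isRegularOfDegree_sumRankGraph (F := F) (n := n) (m := m)
  have hk0 : (Fintype.card F - 1) * Nat.card (RankOneLine F n m) ≠ 0 :=
    mul_ne_zero (by omega) (by omega)
  have hne : C.toFinset.Nonempty := by
    rw [Set.toFinset_nonempty]
    exact Set.nonempty_of_ncard_ne_zero (by omega)
  have hdist : ∀ x c : SumRankSpace F n m, (c = x ∨ (sumRankGraph F n m).Adj x c) →
      sumRank (x - c) ≤ 1 := by
    rintro x c (rfl | h)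
    · simp [sumRank_zero]
    · exact le_of_eq h
  obtain ⟨f, hf0, hf⟩ := exists_adjMatrix_mulVec_eq_neg hk hk0 hne (fun x c hc d hd' hxc hxd => by
    by_contra hcd
    have h3 := three_le_sumRank_sub_of_le_minSumRankDist hd (Set.mem_toFinset.1 hc)
      (Set.mem_toFinset.1 hd') hcd
    -- Two codewords in a common ball of radius `1` are at distance at most `2`.
    have h1 := sumRank_add_le (-(x - c)) (x - d)
    rw [sumRank_neg, show -(x - c) + (x - d) = c - d by abel] at h1
    have := hdist x c hxc
    have := hdist x d hxd
    omega) (by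
    rw [spherePackingBound, ballVolume_one, eq_div_iff (by positivity), Set.ncard_eq_toFinset_card',
      Nat.card_eq_fintype_card (α := SumRankSpace F n m)] at hcard
    exact_mod_cast hcard)
  obtain ⟨z, -, hz⟩ := exists_nat_of_adjMatrix_mulVec_eq_smul hf0 hf
  have hz' : Nat.card (RankOneLine F n m) = 1 + Fintype.card F * z := by
    have : (Nat.card (RankOneLine F n m) : ℝ) = 1 + Fintype.card F * z := by linarith
    exact_mod_cast this
  rw [Nat.card_eq_fintype_card (α := F)] at hNt
  refine hNt.symm.trans ?_
  rw [hz']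
  simp [Nat.ModEq]

/-- The polynomial `(X - a) (X - b)` vanishing at the two elements `a ≤ -1 < b = a + q` of the
progression that contains the eigenvalues certifies the comparison of the two bounds. -/
theorem exists_mem_ratioTypeValues_sumRankGraph [Fintype (SumRankSpace F n m)]
    [DecidableEq (SumRankSpace F n m)] [DecidableRel (sumRankGraph F n m).Adj]
    (hn : ∀ i, 1 ≤ n i) (hm : ∀ i, 1 ≤ m i) (ht : 2 ≤ t) :
    ∃ x ∈ ratioTypeValues (sumRankGraph F n m) 3, x ≤ spherePackingBound F n m 3 ∧
      (¬ t ≡ 1 [MOD Fintype.card F] → x < spherePackingBound F n m 3) := by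
  have hN := ht.trans (le_card_rankOneLine (F := F) hn hm)
  have hNt := card_rankOneLine_modEq (F := F) hn hm
  have hq : 2 ≤ Fintype.card F := Fintype.one_lt_card
  have hk := isRegularOfDegree_sumRankGraph (F := F) (n := n) (m := m)
  have hball := ballVolume_one (F := F) (n := n) (m := m)
  have heig : ∀ i, ∃ z : ℕ, z ≤ Nat.card (RankOneLine F n m) ∧
      adjEigenvalue (sumRankGraph F n m) i =
        Fintype.card F * z - Nat.card (RankOneLine F n m) := fun i => by
    obtain ⟨f, hf0, hf⟩ := exists_adjMatrix_mulVec_eq_adjEigenvalue_smul (sumRankGraph F n m) i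
    exact exists_nat_of_adjMatrix_mulVec_eq_smul hf0 hf
  rw [Nat.card_eq_fintype_card (α := F)] at hNt
  generalize Nat.card (RankOneLine F n m) = N at *
  generalize hQ : Fintype.card F = q at *
  have hkR : (((q - 1) * N : ℕ) : ℝ) = (q - 1) * N := by
    rw [Nat.cast_mul, Nat.cast_sub (by omega), Nat.cast_one]
  generalize (q - 1) * N = k at *
  have hqR : (2 : ℝ) ≤ q := by exact_mod_cast hq
  have hNR : (2 : ℝ) ≤ N := by exact_mod_cast hN
  -- The roots are `a = q w - N = -1 - r` and `b = q (w + 1) - N = q - 1 - r`.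
  obtain ⟨w, r, hr, hw⟩ : ∃ w r : ℕ, r < q ∧ N = 1 + q * w + r :=
    ⟨(N - 1) / q, (N - 1) % q, Nat.mod_lt _ (by omega), by
      have := Nat.div_add_mod (N - 1) q
      omega⟩
  have hrR : (r : ℝ) + 1 ≤ q := by exact_mod_cast hr
  have hr0 : (0 : ℝ) ≤ r := Nat.cast_nonneg r
  have hwR : (N : ℝ) = 1 + q * w + r := by exact_mod_cast hw
  -- Here `N ≥ 2` enters: it places `k` strictly above the root `b`.
  have hk2 : 2 * ((q : ℝ) - 1) ≤ k := by nlinarith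
  have hk0 : (0 : ℝ) < k := by linarith
  have hV0 : (0 : ℝ) < Fintype.card (SumRankSpace F n m) := by exact_mod_cast Fintype.card_pos
  have hV : 1 < Fintype.card (SumRankSpace F n m) := by
    have h0 : k ≠ 0 := by exact_mod_cast hk0.ne'
    have := (sumRankGraph F n m).degree_lt_card_verts 0
    rw [hk 0] at this
    omega
  have hP : (0 : ℝ) < (k - (-1 - r)) * (k - (q - 1 - r)) :=
    mul_pos (by linarith) (by linarith)
  have hid : (k + 1 : ℝ) * (k + (-1 - r) * (q - 1 - r)) =
      (k - (-1 - r)) * (k - (q - 1 - r)) - k * (r * (q - r)) := by ring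
  have hnonneg : (0 : ℝ) ≤ k * (r * (q - r)) :=
    mul_nonneg hk0.le (mul_nonneg hr0 (by linarith))
  obtain ⟨x, hx, hxle⟩ := exists_mem_ratioTypeValues_le (a := -1 - r) (b := q - 1 - r) hV hk
    (fun i => by
      obtain ⟨z, hz, h⟩ := heig i
      have hzR : (z : ℝ) ≤ N := by exact_mod_cast hz
      rw [h, hkR]
      nlinarith)
    (fun i => by
      obtain ⟨z, -, h⟩ := heig i
      -- No integer lies strictly between `w` and `w + 1`; the product at hand is `q ^ 2` times this
      -- one.
      have hint : (0 : ℝ) ≤ ((z : ℝ) - w) * (z - w - 1) := by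
        have : (0 : ℤ) ≤ ((z : ℤ) - w) * (z - w - 1) := by
          rcases le_or_gt ((z : ℤ) - w) 0 with h | h
          · exact mul_nonneg_of_nonpos_of_nonpos h (by omega)
          · exact mul_nonneg h.le (by omega)
        exact_mod_cast this
      rw [h, hwR]
      have := mul_nonneg (sq_nonneg (q : ℝ)) hint
      linarith)
    (by
      rcases le_or_gt (k + (-1 - r) * (q - 1 - r) : ℝ) 0 with h | h
      · linarith
      · have := mul_pos hk0 h
        linarith)
  have hSP : spherePackingBound F n m 3 =
      Fintype.card (SumRankSpace F n m) * (1 / (k + 1 : ℝ)) := by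
    rw [spherePackingBound, Nat.card_eq_fintype_card, hball]
    push_cast
    ring
  refine ⟨x, hx, hxle.trans ?_, fun hne => hxle.trans_lt ?_⟩
  · rw [hSP]
    refine mul_le_mul_of_nonneg_left ?_ hV0.le
    rw [div_le_div_iff₀ hP (by linarith)]
    linarith
  · rw [hSP]
    refine mul_lt_mul_of_pos_left ?_ hV0
    have hr1 : r ≠ 0 := by
      rintro rfl
      refine hne (hNt.symm.trans ?_)
      rw [hw]
      simp [Nat.ModEq]
    have hr1R : (0 : ℝ) < r := by exact_mod_cast Nat.pos_of_ne_zero hr1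
    have := mul_pos hk0 (mul_pos hr1R (show (0 : ℝ) < q - r by linarith))
    rw [div_lt_div_iff₀ hP (by linarith)]
    linarith

end SumRankCodes

theorem one_le_oneBlock {t a : ℕ} (ha : 1 ≤ a) (i : Fin t) : 1 ≤ oneBlock t a i := by
  unfold oneBlock
  split_ifs <;> omega

theorem mainTheorem6 {F : Type*} [Field F] [Fintype F] (q n m t : ℕ)
    (hq : Fintype.card F = q) (hn : 1 ≤ n) (hnm : n ≤ m) (ht : 2 ≤ t) :
    ratioTypeBound F (oneBlock t n) (oneBlock t m) 3 ≤
        spherePackingBound F (oneBlock t n) (oneBlock t m) 3 ∧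
      (¬ t ≡ 1 [MOD q] →
        ratioTypeBound F (oneBlock t n) (oneBlock t m) 3 <
          spherePackingBound F (oneBlock t n) (oneBlock t m) 3) ∧
      (¬ t ≡ 1 [MOD q] →
        ¬ ∃ C : Set (SumRankSpace F (oneBlock t n) (oneBlock t m)),
          IsPerfectSumRankCode C 3) := by
  classical
  subst hq
  have hn' := one_le_oneBlock (t := t) hn
  have hm' := one_le_oneBlock (t := t) (hn.trans hnm)
  obtain ⟨x, hx, hle, hlt⟩ := exists_mem_ratioTypeValues_sumRankGraph (F := F) hn' hm' ht
  have hRT : ratioTypeBound F (oneBlock t n) (oneBlock t m) 3 ≤ x := by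
    -- The infimum bounds its members from below only because the set of values is bounded below,
    -- here by `1`.
    refine csInf_le ⟨1, fun y hy => one_le_of_mem_ratioTypeValues _ 3 hy⟩ ?_
    convert hx
  exact ⟨hRT.trans hle, fun h => hRT.trans_lt (hlt h), fun h ⟨C, hC⟩ =>
    h (modEq_one_of_isPerfectSumRankCode hn' hm' (by omega) hC)⟩
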